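/- For a squarefree integer $d$ (possibly negative), let $H^d$ be the smooth projective genus one curve over $\mathbb{Q}$ with affine equation $$H^d:\quad d y^2=(x^2-x-3)(x^2+2x-12),$$ that is, the curve $dY^2=(X^2-XZ-3Z^2)(X^2+2XZ-12Z^2)$ in the weighted projective plane $\mathbb{P}(1,2,1)$ with coordinates $(X:Y:Z)$. If $H^d(\mathbb{Q})\neq\emptyset$, then $H^d(\mathbb{Q})$ is infinite. -/

import Mathlib

namespace QuarticTwist

/-- The binary quartic form `F(X, Z) = (X² - XZ - 3Z²)(X² + 2XZ - 12Z²)`, the homogenization of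
`f(x) = (x² - x - 3)(x² + 2x - 12)`. -/
def quarticForm (X Z : ℚ) : ℚ :=
  (X ^ 2 - X * Z - 3 * Z ^ 2) * (X ^ 2 + 2 * X * Z - 12 * Z ^ 2)

/-- Rational weighted homogeneous coordinates `(X, Y, Z)`, of weights `1, 2, 1`, of a point of the
curve `d Y² = F(X, Z)`. For `d ≠ 0` the equation rules out `X = Z = 0` except for the excluded
triple `(0, 0, 0)`. -/
structure Coords (d : ℤ) where
  X : ℚ
  Y : ℚ
  Z : ℚ
  ne_zero : X ≠ 0 ∨ Z ≠ 0
  equation : (d : ℚ) * Y ^ 2 = quarticForm X Z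

/-- Two coordinate triples give the same point when they differ by the weighted scaling
`(X, Y, Z) ↦ (c X, c² Y, c Z)` with `c ∈ ℚˣ`. -/
def coordsSetoid (d : ℤ) : Setoid (Coords d) where
  r P Q := ∃ c : ℚ, c ≠ 0 ∧ Q.X = c * P.X ∧ Q.Y = c ^ 2 * P.Y ∧ Q.Z = c * P.Z
  iseqv :=
    { refl := fun P => ⟨1, one_ne_zero, by ring, by ring, by ring⟩
      symm := by
        rintro P Q ⟨c, hc, hX, hY, hZ⟩
        refine ⟨c⁻¹, inv_ne_zero hc, ?_, ?_, ?_⟩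
        · rw [hX]; field_simp
        · rw [hY]; field_simp
        · rw [hZ]; field_simp
      trans := by
        rintro P Q R ⟨c, hc, hX, hY, hZ⟩ ⟨e, he, hX', hY', hZ'⟩
        refine ⟨e * c, mul_ne_zero he hc, ?_, ?_, ?_⟩
        · rw [hX', hX]; ring
        · rw [hY', hY]; ring
        · rw [hZ', hZ]; ring }

/-- The set `H^d(ℚ)` of rational points of the smooth projective genus one curve
`H^d : d y² = (x² - x - 3)(x² + 2x - 12)`, embedded in the weighted projective plane `ℙ(1, 2, 1)`.
The points with `Z ≠ 0` are the affine solutions `(x, y) = (X / Z, Y / Z²)`; the points at infinity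
are `(1 : t : 0)` with `d t² = 1`. -/
def RationalPoint (d : ℤ) : Type :=
  Quotient (coordsSetoid d)

end QuarticTwist

/-!
The Jacobian of `H^d` is `E : y² = (x + 9d)(x + 13d)(x + 117d)`, and `H^d` is the two-covering of
`E` given by `x + 9d = r²`, `x + 13d = 13s²`, `x + 117d = 13t²`. The abscissae of the images of
rational points of `H^d` are therefore exactly the rational numbers in the square classes
`(1, 13, 13)`, so it suffices that one such number yields infinitely many.

On `E(ℚ)` the classes multiply under addition and doubles have trivial class, so a point `Q` of
class `(1, 13, 13)` drags the whole coset `Q + 2E(ℚ)` into its class. The points of order two have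
neither this class nor the trivial one. Hence `E(ℚ)` has no point of order four and the coset avoids
the two-torsion, which forces `Q` to have infinite order.
-/

open WeierstrassCurve

/-! ### Doubling in additive monoids -/

theorem not_isOfFinAddOrder_of_two_nsmul_ne_zero {M : Type*} [AddMonoid M] {Q : M}
    (h₄ : ∀ R : M, 2 • 2 • R = 0 → 2 • R = 0) (hQ : ∀ R : M, 2 • (Q + 2 • R) ≠ 0) :
    ¬ IsOfFinAddOrder Q := by
  have two_pow_ne (R : M) (k : ℕ) : 2 • 2 ^ k • (Q + 2 • R) ≠ 0 := by
    induction k with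
    | zero => simpa only [pow_zero, one_nsmul] using hQ R
    | succ k ih =>
      rw [pow_succ, mul_nsmul]
      exact fun h => ih (h₄ _ h)
  rw [isOfFinAddOrder_iff_nsmul_eq_zero]
  rintro ⟨n, hn, hnQ⟩
  obtain ⟨k, _, ⟨j, rfl⟩, rfl⟩ := Nat.exists_eq_two_pow_mul_odd hn.ne'
  refine two_pow_ne (j • Q) k ?_
  rw [← mul_nsmul' Q, ← succ_nsmul', ← mul_nsmul' _ (2 ^ k), hnQ, nsmul_zero]

theorem infinite_range_add_two_nsmul {M : Type*} [AddLeftCancelMonoid M] {Q : M}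
    (hQ : ¬ IsOfFinAddOrder Q) : (Set.range fun R : M => Q + 2 • R).Infinite := by
  refine Set.infinite_of_injective_forall_mem (f := fun k : ℕ => (2 * k + 1) • Q) ?_
    fun k => ⟨k • Q, by simp only [← mul_nsmul', ← succ_nsmul']⟩
  intro k l hkl
  have := injective_nsmul_iff_not_isOfFinAddOrder.mpr hQ hkl
  lia

/-! ### Complete two-descent on a cubic with rational roots -/

theorem isSquare_left_of_mul {G₀ : Type*} [CommGroupWithZero G₀] {u v : G₀}
    (h : IsSquare (u * v)) (hv : IsSquare v) (hv₀ : v ≠ 0) : IsSquare u := by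
  simpa only [mul_div_cancel_right₀ u hv₀] using h.div hv

section Descent

variable {F : Type*} [Field F]

/-- The Weierstrass curve `y² = (x - e₀)(x - e₁)(x - e₂)`. -/
def splitCubic (e : Fin 3 → F) : Affine F :=
  ⟨0, -(e 0 + e 1 + e 2), 0, e 0 * e 1 + e 0 * e 2 + e 1 * e 2, -(e 0 * e 1 * e 2)⟩

/-- Membership of `x - eᵢ` in the square class of `aᵢ` for every `i`. It is written as a product so
that it holds automatically for the indices with `x = eᵢ`. -/
def InSquareClass (e a : Fin 3 → F) (x : F) : Prop :=
  ∀ i, IsSquare (a i * (x - e i))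

/-- The condition that the two-descent map of `splitCubic e` sends `P` to the class of `a`, in
projective form so that the point at infinity has trivial class. At the points of order two it does
not constrain the component where the descent map needs a separate definition. -/
def HasDescentClass (e a : Fin 3 → F) (P : (splitCubic e).Point) : Prop :=
  ∀ i, IsSquare (a i * (P.xRep 0 - P.xRep 1 * e i))

theorem addX_sub_mul_sub_mul_sub [DecidableEq F] {W : Affine F} {e y₀ x₁ x₂ y₁ y₂ : F}
    (h₀ : W.Equation e y₀) (h₁ : W.Equation x₁ y₁) (h₂ : W.Equation x₂ y₂)
    (hxy : ¬ (x₁ = x₂ ∧ y₁ = W.negY x₂ y₂)) :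
    (W.addX x₁ x₂ (W.slope x₁ x₂ y₁ y₂) - e) * ((x₁ - e) * (x₂ - e)) =
      (W.slope x₁ x₂ y₁ y₂ * (e - x₁) + y₁ - y₀) *
        (W.slope x₁ x₂ y₁ y₂ * (e - x₁) + y₁ - W.negY e y₀) := by
  have h := congr_arg (Polynomial.eval e) (Affine.addPolynomial_slope h₁ h₂ hxy)
  rw [Affine.equation_iff] at h₀
  rw [Affine.addPolynomial_eq] at h
  simp only [Cubic.toPoly, Polynomial.eval_neg, Polynomial.eval_add, Polynomial.eval_mul,
    Polynomial.eval_C, Polynomial.eval_pow, Polynomial.eval_X, Polynomial.eval_sub] at h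
  rw [Affine.negY]
  linear_combination h₀ - h

theorem finite_preimage_xRep {W : Affine F} {s : Set (Fin 2 → F)} (hs : s.Finite) :
    ((Affine.Point.xRep : W.Point → Fin 2 → F) ⁻¹' s).Finite := by
  refine hs.preimage' fun v _ => ?_
  rcases (Affine.Point.xRep ⁻¹' {v} : Set W.Point).eq_empty_or_nonempty with h | ⟨P, rfl⟩
  · rw [h]
    exact Set.finite_empty
  · exact (Set.toFinite {P, -P}).subset fun Q hQ => Affine.Point.eq_or_eq_neg_of_xRep_eq_xRep hQ

variable {e a b : Fin 3 → F} {x y : F}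

theorem splitCubic_equation_iff : (splitCubic e).Equation x y ↔ y ^ 2 = ∏ i, (x - e i) := by
  rw [Affine.equation_iff, Fin.prod_univ_three]
  simp only [splitCubic]
  constructor <;> intro h <;> linear_combination h

theorem splitCubic_negY : (splitCubic e).negY x y = -y := by
  simp only [Affine.negY, splitCubic, zero_mul, sub_zero]

theorem splitCubic_equation_root (i : Fin 3) : (splitCubic e).Equation (e i) 0 := by
  rw [splitCubic_equation_iff, Finset.prod_eq_zero (Finset.mem_univ i) (sub_self _),
    zero_pow two_ne_zero]

theorem splitCubic_y_eq_zero_iff (h : (splitCubic e).Equation x y) :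
    y = 0 ↔ ∃ i, x = e i := by
  rw [← sq_eq_zero_iff, splitCubic_equation_iff.mp h, Finset.prod_eq_zero_iff]
  simp only [Finset.mem_univ, true_and, sub_eq_zero]

theorem hasDescentClass_some {h : (splitCubic e).Nonsingular x y} :
    HasDescentClass e a (.some x y h) ↔ InSquareClass e a x := by
  simp [HasDescentClass, InSquareClass]

theorem hasDescentClass_zero : HasDescentClass e a 0 ↔ ∀ i, IsSquare (a i) := by
  simp [HasDescentClass]

theorem isSquare_addX_sub_mul_sub_mul_sub [DecidableEq F] {x₁ x₂ y₁ y₂ : F}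
    (h₁ : (splitCubic e).Equation x₁ y₁) (h₂ : (splitCubic e).Equation x₂ y₂)
    (hxy : ¬ (x₁ = x₂ ∧ y₁ = (splitCubic e).negY x₂ y₂)) (i : Fin 3) :
    IsSquare (((splitCubic e).addX x₁ x₂ ((splitCubic e).slope x₁ x₂ y₁ y₂) - e i) *
      ((x₁ - e i) * (x₂ - e i))) := by
  rw [addX_sub_mul_sub_mul_sub (splitCubic_equation_root i) h₁ h₂ hxy, splitCubic_negY, neg_zero]
  exact .mul_self _

variable [NeZero (2 : F)]

theorem splitCubic_y_eq_negY_iff : y = (splitCubic e).negY x y ↔ y = 0 := by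
  rw [splitCubic_negY, eq_neg_iff_add_eq_zero, ← two_mul, mul_eq_zero_iff_left two_ne_zero]

theorem splitCubic_nonsingular (h : (splitCubic e).Equation x y) (hx : ∀ i, x ≠ e i) :
    (splitCubic e).Nonsingular x y := by
  have hy : y ≠ (splitCubic e).negY x y := by
    rw [Ne, splitCubic_y_eq_negY_iff, splitCubic_y_eq_zero_iff h]
    exact not_exists.mpr hx
  exact (Affine.nonsingular_iff ..).mpr ⟨h, .inr hy⟩

section PointGroup

variable [DecidableEq F]

theorem two_nsmul_some_eq_zero_iff {h : (splitCubic e).Nonsingular x y} :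
    2 • Affine.Point.some x y h = 0 ↔ ∃ i, x = e i := by
  rw [← splitCubic_y_eq_zero_iff h.1, ← splitCubic_y_eq_negY_iff (e := e) (x := x), two_nsmul]
  refine ⟨fun h2 => ?_, Affine.Point.add_self_of_Y_eq⟩
  by_contra hy
  exact Affine.Point.some_ne_zero _ ((Affine.Point.add_self_of_Y_ne hy).symm.trans h2)

theorem HasDescentClass.add {P Q : (splitCubic e).Point} (hP : HasDescentClass e a P)
    (hQ : HasDescentClass e b Q) (hP₂ : 2 • P = 0 → P = 0) (hQ₂ : 2 • Q = 0 → Q = 0) :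
    HasDescentClass e (a * b) (P + Q) := by
  rcases P with _ | ⟨x₁, y₁, h₁⟩
  · rw [← Affine.Point.zero_def] at hP ⊢
    rw [zero_add]
    intro i
    simpa only [Pi.mul_apply, mul_assoc] using (hasDescentClass_zero.mp hP i).mul (hQ i)
  rcases Q with _ | ⟨x₂, y₂, h₂⟩
  · rw [← Affine.Point.zero_def] at hQ ⊢
    rw [add_zero]
    intro i
    simpa only [Pi.mul_apply, mul_right_comm] using (hP i).mul (hasDescentClass_zero.mp hQ i)
  have hx₁ (i) : x₁ - e i ≠ 0 := fun h => Affine.Point.some_ne_zero _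
    (hP₂ (two_nsmul_some_eq_zero_iff.mpr ⟨i, sub_eq_zero.mp h⟩))
  have hx₂ (i) : x₂ - e i ≠ 0 := fun h => Affine.Point.some_ne_zero _
    (hQ₂ (two_nsmul_some_eq_zero_iff.mpr ⟨i, sub_eq_zero.mp h⟩))
  rw [hasDescentClass_some] at hP hQ
  have hprod (i) : IsSquare ((a * b) i * ((x₁ - e i) * (x₂ - e i))) := by
    simpa only [Pi.mul_apply, mul_mul_mul_comm] using (hP i).mul (hQ i)
  by_cases hxy : x₁ = x₂ ∧ y₁ = (splitCubic e).negY x₂ y₂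
  · rw [Affine.Point.add_of_Y_eq hxy.1 hxy.2, hasDescentClass_zero]
    intro i
    have h := hprod i
    rw [hxy.1] at h
    exact isSquare_left_of_mul h (.mul_self _) (mul_ne_zero (hx₂ i) (hx₂ i))
  · rw [Affine.Point.add_some hxy, hasDescentClass_some]
    intro i
    refine isSquare_left_of_mul ?_ (.mul_self ((x₁ - e i) * (x₂ - e i)))
      (mul_self_ne_zero.mpr (mul_ne_zero (hx₁ i) (hx₂ i)))
    rw [mul_mul_mul_comm]
    exact (hprod i).mul (isSquare_addX_sub_mul_sub_mul_sub h₁.1 h₂.1 hxy i)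

theorem hasDescentClass_one_two_nsmul (P : (splitCubic e).Point) :
    HasDescentClass e 1 (2 • P) := by
  by_cases hP : 2 • P = 0
  · rw [hP, hasDescentClass_zero]
    exact fun _ => .one
  rcases P with _ | ⟨x, y, h⟩
  · exact absurd (nsmul_zero 2) hP
  have hx := two_nsmul_some_eq_zero_iff.not.mp hP
  push Not at hx
  have hP_class : HasDescentClass e (fun i => x - e i) (.some x y h) :=
    hasDescentClass_some.mpr fun i => .mul_self _
  rw [two_nsmul]
  intro i
  refine isSquare_left_of_mul (v := (x - e i) * (x - e i)) ?_ (.mul_self _) ?_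
  · rw [Pi.one_apply, one_mul, mul_comm]
    exact hP_class.add hP_class (fun h => absurd h hP) (fun h => absurd h hP) i
  · exact mul_self_ne_zero.mpr (sub_ne_zero.mpr (hx i))

theorem HasDescentClass.eq_zero_of_two_nsmul {P : (splitCubic e).Point}
    (ha : ∀ j, ¬ InSquareClass e a (e j)) (hP : HasDescentClass e a P) (h : 2 • P = 0) : P = 0 := by
  rcases P with _ | ⟨x, y, hxy⟩
  · rfl
  · obtain ⟨j, rfl⟩ := two_nsmul_some_eq_zero_iff.mp h
    exact absurd (hasDescentClass_some.mp hP) (ha j)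

theorem HasDescentClass.add_two_nsmul (h₁ : ∀ j, ¬ InSquareClass e 1 (e j))
    (ha : ∀ j, ¬ InSquareClass e a (e j)) {Q : (splitCubic e).Point} (hQ : HasDescentClass e a Q)
    (R : (splitCubic e).Point) : HasDescentClass e a (Q + 2 • R) := by
  simpa only [mul_one] using
    hQ.add (hasDescentClass_one_two_nsmul R) (hQ.eq_zero_of_two_nsmul ha)
      ((hasDescentClass_one_two_nsmul R).eq_zero_of_two_nsmul h₁)

end PointGroup

theorem HasDescentClass.infinite (h₁ : ∀ j, ¬ InSquareClass e 1 (e j))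
    (ha : ∀ j, ¬ InSquareClass e a (e j)) (ha₀ : ¬ ∀ i, IsSquare (a i))
    {Q : (splitCubic e).Point} (hQ : HasDescentClass e a Q) :
    {P | HasDescentClass e a P}.Infinite := by
  classical
  have hQ_order : ¬ IsOfFinAddOrder Q := by
    refine not_isOfFinAddOrder_of_two_nsmul_ne_zero
      (fun R => (hasDescentClass_one_two_nsmul R).eq_zero_of_two_nsmul h₁) fun R h => ha₀ ?_
    have hR := hQ.add_two_nsmul h₁ ha R
    exact hasDescentClass_zero.mp (hR.eq_zero_of_two_nsmul ha h ▸ hR)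
  exact (infinite_range_add_two_nsmul hQ_order).mono
    (Set.range_subset_iff.mpr (hQ.add_two_nsmul h₁ ha))

theorem InSquareClass.exists_hasDescentClass (ha : ∀ j, ¬ InSquareClass e a (e j))
    (ha_prod : IsSquare (∏ i, a i)) (ha_ne : ∏ i, a i ≠ 0) (hx : InSquareClass e a x) :
    ∃ Q, HasDescentClass e a Q := by
  obtain ⟨y, hy⟩ : IsSquare (∏ i, (x - e i)) := by
    refine isSquare_left_of_mul ?_ ha_prod ha_ne
    rw [mul_comm, ← Finset.prod_mul_distrib]
    exact Finset.isSquare_prod _ fun i _ => hx i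
  have hxy : (splitCubic e).Equation x y := splitCubic_equation_iff.mpr (by rw [hy, sq])
  exact ⟨.some x y (splitCubic_nonsingular hxy fun j hj => ha j (hj ▸ hx)),
    hasDescentClass_some.mpr hx⟩

theorem InSquareClass.infinite (h₁ : ∀ j, ¬ InSquareClass e 1 (e j))
    (ha : ∀ j, ¬ InSquareClass e a (e j)) (ha₀ : ¬ ∀ i, IsSquare (a i))
    (ha_prod : IsSquare (∏ i, a i)) (ha_ne : ∏ i, a i ≠ 0) (hx : InSquareClass e a x) :
    {x | InSquareClass e a x}.Infinite := by
  classical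
  obtain ⟨Q, hQ⟩ := hx.exists_hasDescentClass ha ha_prod ha_ne
  refine fun hfin => hQ.infinite h₁ ha ha₀ <|
    (finite_preimage_xRep (hfin.image fun x => ![x, 1])).subset ?_
  rintro (_ | ⟨x, y, h⟩) hP
  · exact absurd (hasDescentClass_zero.mp hP) ha₀
  · exact ⟨x, hasDescentClass_some.mp hP, (Affine.Point.xRep_some h).symm⟩

end Descent

/-! ### The quartic twists -/

theorem sq_add_mul_add_mul_sq_ne_zero {F : Type*} [Field F] {b c X Z : F}
    (hdisc : ¬ IsSquare (b ^ 2 - 4 * c)) (h : X ≠ 0 ∨ Z ≠ 0) :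
    X ^ 2 + b * (X * Z) + c * Z ^ 2 ≠ 0 := by
  intro h₀
  have hZ : Z = 0 := by
    by_contra hZ
    refine hdisc (isSquare_left_of_mul (v := Z ^ 2) ⟨2 * X + b * Z, ?_⟩ (.sq Z) (pow_ne_zero 2 hZ))
    linear_combination -4 * h₀
  subst hZ
  have hX : X = 0 := by simpa using h₀
  simp [hX] at h

theorem exists_sq_eq_mul_of_sq_eq_mul {M : Type*} [CommMonoidWithZero M] [NoZeroDivisors M]
    [Nontrivial M] {α β γ : M} (h : β ^ 2 = α * γ) :
    ∃ X Y Z : M, Y ≠ 0 ∧ X ^ 2 = Y * α ∧ X * Z = Y * β ∧ Z ^ 2 = Y * γ := by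
  by_cases hα : α = 0
  · obtain rfl : β = 0 := by simpa [hα] using h
    by_cases hγ : γ = 0
    · exact ⟨0, 1, 0, one_ne_zero, by simp [hα], by simp, by simp [hγ]⟩
    · exact ⟨0, γ, γ, hγ, by simp [hα], by simp, sq γ⟩
  · exact ⟨α, α, β, hα, sq α, rfl, h⟩

namespace QuarticTwist

/-- The roots of the Jacobian `y² = (x + 9d)(x + 13d)(x + 117d)` of `H^d`. -/
def jacobianRoots (d : ℚ) : Fin 3 → ℚ :=
  ![-9 * d, -13 * d, -117 * d]

theorem not_inSquareClass_jacobianRoots {d q : ℚ} (hd : d ≠ 0) (hq : 0 < q)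
    (hq₇₈ : ¬ IsSquare (78 * q)) (j : Fin 3) :
    ¬ InSquareClass (jacobianRoots d) ![1, q, q] (jacobianRoots d j) := by
  intro h
  have h₀ := h 0
  have h₁ := h 1
  have h₂ := h 2
  simp only [jacobianRoots, Matrix.cons_val] at h₀ h₁ h₂
  -- For each root, the product of the other two conditions is, up to squares, one on `3`, on a
  -- negative number and on `78q` respectively.
  fin_cases j <;> simp only [Fin.zero_eta, Fin.mk_one, Fin.reduceFinMk, Matrix.cons_val] at h₀ h₁ h₂
  · have h₃ : ¬ IsSquare (3 : ℚ) := by norm_num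
    obtain ⟨m, hm⟩ := h₁.mul h₂
    exact h₃ <| isSquare_left_of_mul (v := (12 * q * d) ^ 2) ⟨m, by linear_combination hm⟩ (.sq _)
      (by positivity)
  · have := (h₀.mul h₂).nonneg
    have : 0 < q * d ^ 2 := by positivity
    linarith
  · obtain ⟨m, hm⟩ := h₀.mul h₁
    exact hq₇₈ <| isSquare_left_of_mul (v := (12 * d) ^ 2) ⟨m, by linear_combination hm⟩ (.sq _)
      (by positivity)

theorem inSquareClass_jacobianRoots_infinite {d x : ℚ} (hd : d ≠ 0)
    (hx : InSquareClass (jacobianRoots d) ![1, 13, 13] x) :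
    {x | InSquareClass (jacobianRoots d) ![1, 13, 13] x}.Infinite := by
  have h₁₃ : ¬ IsSquare (13 : ℚ) := by norm_num
  have h_one (j) : ¬ InSquareClass (jacobianRoots d) 1 (jacobianRoots d j) := by
    have h_cons : (1 : Fin 3 → ℚ) = ![1, 1, 1] := by
      ext i
      fin_cases i <;> rfl
    rw [h_cons]
    exact not_inSquareClass_jacobianRoots hd one_pos (by norm_num) j
  exact hx.infinite h_one
    (not_inSquareClass_jacobianRoots hd (by norm_num) (by norm_num)) (fun h => h₁₃ (h 1))
    ⟨13, by simp [Fin.prod_univ_three]⟩ (by simp [Fin.prod_univ_three])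

theorem quarticForm_ne_zero {X Z : ℚ} (h : X ≠ 0 ∨ Z ≠ 0) : quarticForm X Z ≠ 0 := by
  have h₁ := sq_add_mul_add_mul_sq_ne_zero (b := (-1 : ℚ)) (c := -3) (by norm_num) h
  have h₂ := sq_add_mul_add_mul_sq_ne_zero (b := (2 : ℚ)) (c := -12) (by norm_num) h
  convert mul_ne_zero h₁ h₂ using 1
  rw [quarticForm]
  ring

theorem Coords.d_mul_Y_sq_ne_zero {d : ℤ} (P : Coords d) : (d : ℚ) * P.Y ^ 2 ≠ 0 :=
  P.equation ▸ quarticForm_ne_zero P.ne_zero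

theorem Coords.d_ne_zero {d : ℤ} (P : Coords d) : d ≠ 0 :=
  Int.cast_ne_zero.mp (left_ne_zero_of_mul P.d_mul_Y_sq_ne_zero)

theorem Coords.Y_ne_zero {d : ℤ} (P : Coords d) : P.Y ≠ 0 :=
  ne_zero_pow two_ne_zero (right_ne_zero_of_mul P.d_mul_Y_sq_ne_zero)

/-- The abscissa of the image of a point of `H^d` under the two-covering of its Jacobian, where the
Jacobian is written `y² = (x + 9d)(x + 13d)(x + 117d)`. -/
def Coords.abscissa {d : ℤ} (P : Coords d) : ℚ :=
  9 * ((P.X ^ 2 - 6 * (P.X * P.Z) + 6 * P.Z ^ 2) / P.Y) ^ 2 - 9 * d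

/-- The abscissa of `Coords.abscissa` as a function of the rational point, which is what the
two-covering induces on `H^d(ℚ)`. -/
def RationalPoint.abscissa {d : ℤ} : RationalPoint d → ℚ :=
  Quotient.lift Coords.abscissa <| by
    rintro P Q ⟨c, hc, hX, hY, hZ⟩
    have := P.Y_ne_zero
    simp only [Coords.abscissa, hX, hY, hZ]
    field_simp

theorem Coords.inSquareClass_abscissa {d : ℤ} (P : Coords d) :
    InSquareClass (jacobianRoots d) ![1, 13, 13] P.abscissa := by
  have hY := P.Y_ne_zero
  have hE := P.equation
  rw [quarticForm] at hE
  have h₀ : P.abscissa + 9 * d = (3 * ((P.X ^ 2 - 6 * (P.X * P.Z) + 6 * P.Z ^ 2) / P.Y)) ^ 2 := by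
    rw [abscissa]
    ring
  have h₁ : P.abscissa + 13 * d = 13 * ((P.X ^ 2 - 4 * (P.X * P.Z) + 6 * P.Z ^ 2) / P.Y) ^ 2 := by
    rw [abscissa]
    field_simp
    linear_combination 4 * hE
  have h₂ : P.abscissa + 117 * d = 13 * (3 * (P.X ^ 2 - 6 * P.Z ^ 2) / P.Y) ^ 2 := by
    rw [abscissa]
    field_simp
    linear_combination 108 * hE
  intro i
  fin_cases i <;>
    simp only [jacobianRoots, Fin.zero_eta, Fin.mk_one, Fin.reduceFinMk, Matrix.cons_val, one_mul,
      neg_mul, sub_neg_eq_add, h₀, h₁, h₂, ← mul_assoc]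
  · exact .sq _
  · exact (IsSquare.mul_self 13).mul (.sq _)
  · exact (IsSquare.mul_self 13).mul (.sq _)

theorem exists_abscissa_eq_of_conic {d : ℤ} (hd : d ≠ 0) {α β γ : ℚ} (hconic : β ^ 2 = α * γ)
    (hform : (α - β - 3 * γ) * (α + 2 * β - 12 * γ) = d) :
    ∃ P : RationalPoint d, P.abscissa = 9 * (α - 6 * β + 6 * γ) ^ 2 - 9 * d := by
  obtain ⟨X, Y, Z, hY, hXX, hXZ, hZZ⟩ := exists_sq_eq_mul_of_sq_eq_mul hconic
  have hE : (d : ℚ) * Y ^ 2 = quarticForm X Z := by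
    rw [quarticForm, mul_assoc 2, hXX, hXZ, hZZ, ← hform]
    ring
  have hXZ_ne : X ≠ 0 ∨ Z ≠ 0 := by
    by_contra! h
    have : (d : ℚ) * Y ^ 2 = 0 := by simp [hE, h, quarticForm]
    exact mul_ne_zero (Int.cast_ne_zero.mpr hd) (pow_ne_zero 2 hY) this
  refine ⟨⟦⟨X, Y, Z, hXZ_ne, hE⟩⟧, ?_⟩
  change 9 * ((X ^ 2 - 6 * (X * Z) + 6 * Z ^ 2) / Y) ^ 2 - 9 * (d : ℚ) = _
  rw [hXX, hXZ, hZZ]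
  field_simp

theorem exists_abscissa_eq {d : ℤ} (hd : d ≠ 0) {x : ℚ}
    (hx : InSquareClass (jacobianRoots d) ![1, 13, 13] x) :
    ∃ P : RationalPoint d, P.abscissa = x := by
  obtain ⟨r, hr⟩ := hx 0
  obtain ⟨s, hs⟩ := hx 1
  obtain ⟨t, ht⟩ := hx 2
  simp only [jacobianRoots, Matrix.cons_val] at hr hs ht
  -- The witnesses solve `α - 6β + 6γ = r / 3`, `α - 4β + 6γ = s / 13`, `α - 6γ = t / 39`, the
  -- equations between the square roots above and `(α, β, γ) = (X², XZ, Z²) / Y`.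
  obtain ⟨P, hP⟩ := exists_abscissa_eq_of_conic hd
    (α := (t / 39 - 2 * (r / 3) + 3 * (s / 13)) / 2) (β := (s / 13 - r / 3) / 2)
    (γ := (-(t / 39) - 2 * (r / 3) + 3 * (s / 13)) / 12)
    (by linear_combination (-2 * hr + 27 / 169 * hs - ht / 169) / 216)
    (by linear_combination (hs - ht) / (8 * 169))
  refine ⟨P, hP.trans ?_⟩
  linear_combination -hr

theorem range_abscissa {d : ℤ} (hd : d ≠ 0) :
    Set.range (RationalPoint.abscissa (d := d)) =
      {x | InSquareClass (jacobianRoots d) ![1, 13, 13] x} := by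
  ext x
  refine ⟨?_, exists_abscissa_eq hd⟩
  rintro ⟨⟨P⟩, rfl⟩
  exact P.inSquareClass_abscissa

end QuarticTwist

theorem proposition3p4_general (d : ℤ) (h : Nonempty (QuarticTwist.RationalPoint d)) :
    Infinite (QuarticTwist.RationalPoint d) := by
  obtain ⟨⟨P⟩⟩ := h
  have hrange : (Set.range (QuarticTwist.RationalPoint.abscissa (d := d))).Infinite := by
    rw [QuarticTwist.range_abscissa P.d_ne_zero]
    exact QuarticTwist.inSquareClass_jacobianRoots_infinite (Int.cast_ne_zero.mpr P.d_ne_zero)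
      P.inSquareClass_abscissa
  exact not_finite_iff_infinite.mp fun _ => hrange (Set.finite_range _)

theorem proposition3p4 (d : ℤ) (hd : Squarefree d)
    (h : Nonempty (QuarticTwist.RationalPoint d)) :
    Infinite (QuarticTwist.RationalPoint d) :=
  proposition3p4_general d h
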